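/- For $n\ge 1$ let $\mathrm{NC}(n)$ be the (finite) set of non-crossing partitions of $\{1,\dots,n\}$, i.e. of the partitions for which there are no distinct blocks $V_1\ne V_2$ and elements $x_1,y_1\in V_1$, $x_2,y_2\in V_2$ with $x_1<x_2<y_1<y_2$. For $\pi\in\mathrm{NC}(n)$ with $r$ blocks of sizes $B_1,\dots,B_r$, let $$\lambda(\pi)=\frac1r\sum_{j=1}^r\delta_{B_j},$$ a probability measure on $\mathbb N=\{1,2,3,\dots\}$. Let $\mathfrak G_2$ be the geometric distribution with parameter $\tfrac12$ on $\mathbb N$, $\mathfrak G_2(\{k\})=2^{-k}$. (i) Let $\pi_1,\pi_2,\dots$ be random variables on a common probability space, with any joint distribution, such that $\pi_n$ is uniformly distributed on $\mathrm{NC}(n)$ for every $n\ge 1$, and put $\lambda_n=\lambda(\pi_n)$. Then, almost surely, $\lambda_n$ converges weakly to $\mathfrak G_2$ as $n\to\infty$. (ii) For a probability measure $\mu$ on $\mathbb N$ let $m_1(\mu)=\sum_k k\,\mu(\{k\})\in[1,\infty]$ be its mean and $H(\mu)=-\sum_k\mu(\{k\})\log\mu(\{k\})$ its entropy. For $m\in\mathbb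 R$, a finite measure $\mu$ on $\mathbb N$ and $t\in[0,1]$ let $$J(m,\mu,t)=\log 4-\frac1m H(\mu)-\frac1m\log(m-1)+\log\Bigl(1-\frac1m\Bigr)$$ if $\mu$ is a probability measure and $m_1(\mu)=m=\frac1{2t}$ (for $m=1$ the expression is read as its limiting value $\log 4$), and $J(m,\mu,t)=+\infty$ otherwise. Then $J(m,\mu,t)=0$ if and only if $(m,\mu,t)=(2,\mathfrak G_2,\tfrac14)$. -/

import Mathlib

open MeasureTheory ProbabilityTheory Filter
open scoped Topology ENNReal NNReal

noncomputable section

/-- The positive integers carry the discrete sigma-algebra. -/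
instance instMeasurableSpacePosNat : MeasurableSpace ℕ+ := ⊤

instance instDiscreteMeasurableSpacePosNat : DiscreteMeasurableSpace ℕ+ := ⟨fun _ => trivial⟩

/-- A partition of an `n`-element linearly ordered set is non-crossing if there are no distinct
blocks `V₁`, `V₂` and `x₁, y₁ ∈ V₁`, `x₂, y₂ ∈ V₂` with `x₁ < x₂ < y₁ < y₂`. -/
def IsNonCrossing {n : ℕ} (π : Finpartition (Finset.univ : Finset (Fin n))) : Prop :=
  ∀ V₁ ∈ π.parts, ∀ V₂ ∈ π.parts, V₁ ≠ V₂ →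
    ¬ ∃ x₁ ∈ V₁, ∃ y₁ ∈ V₁, ∃ x₂ ∈ V₂, ∃ y₂ ∈ V₂, x₁ < x₂ ∧ x₂ < y₁ ∧ y₁ < y₂

/-- The set `NC(n)` of non-crossing partitions of an `n`-element linearly ordered set. -/
def NC (n : ℕ) : Type := {π : Finpartition (Finset.univ : Finset (Fin n)) // IsNonCrossing π}

instance instFiniteNC (n : ℕ) : Finite (NC n) :=
  inferInstanceAs (Finite {π : Finpartition (Finset.univ : Finset (Fin n)) // IsNonCrossing π})

theorem isNonCrossing_bot (n : ℕ) :
    IsNonCrossing (⊥ : Finpartition (Finset.univ : Finset (Fin n))) := by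
  rintro V₁ h₁ V₂ - - ⟨x₁, hx₁, y₁, hy₁, x₂, -, y₂, -, h, h', -⟩
  obtain ⟨a, -, rfl⟩ := Finpartition.mem_bot_iff.1 h₁
  simp only [Finset.mem_singleton] at hx₁ hy₁
  subst hx₁ hy₁
  exact absurd (h.trans h') (lt_irrefl _)

instance instNonemptyNC (n : ℕ) : Nonempty (NC n) := ⟨⟨⊥, isNonCrossing_bot n⟩⟩

instance instMeasurableSpaceNC (n : ℕ) : MeasurableSpace (NC n) := ⊤

instance instDiscreteMeasurableSpaceNC (n : ℕ) : DiscreteMeasurableSpace (NC n) :=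
  ⟨fun _ => trivial⟩

/-- The uniform distribution on `NC(n)`. -/
def uniformNC (n : ℕ) : Measure (NC n) := uniformOn Set.univ

instance instIsProbabilityMeasureUniformNC (n : ℕ) : IsProbabilityMeasure (uniformNC n) :=
  isProbabilityMeasure_uniformOn Set.finite_univ Set.univ_nonempty

namespace NC

variable {n : ℕ}

/-- The size of a block, as a positive integer. -/
def blockSize (π : NC n) (V : π.1.parts) : ℕ+ :=
  ⟨V.1.card, (π.1.nonempty_of_mem_parts V.2).card_pos⟩

/-- The measure `r⁻¹ ∑ⱼ δ_{Bⱼ}`, where `B₁, …, B_r` are the block sizes. -/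
def blockMeasureAux (π : NC n) : Measure ℕ+ :=
  (π.1.parts.card : ℝ≥0∞)⁻¹ • ∑ V : π.1.parts, Measure.dirac (π.blockSize V)

theorem isProbabilityMeasure_blockMeasureAux (hn : 0 < n) (π : NC n) :
    IsProbabilityMeasure π.blockMeasureAux := by
  have : NeZero n := ⟨hn.ne'⟩
  have h : π.1.parts.card ≠ 0 := by
    rw [Finset.card_ne_zero]
    exact π.1.parts_nonempty (Finset.univ_nonempty.ne_empty)
  constructor
  simp only [blockMeasureAux, Measure.smul_apply, Measure.coe_finsetSum, Finset.sum_apply,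
    measure_univ, Finset.sum_const, Finset.card_univ, Fintype.card_coe, smul_eq_mul, nsmul_eq_mul,
    mul_one]
  exact ENNReal.inv_mul_cancel (by exact_mod_cast h) (ENNReal.natCast_ne_top _)

/-- The empirical block-size measure of a non-crossing partition of a set with `n ≥ 1` elements. -/
def blockMeasure {n : ℕ+} (π : NC n) : ProbabilityMeasure ℕ+ :=
  ⟨π.blockMeasureAux, isProbabilityMeasure_blockMeasureAux n.pos π⟩

end NC

/-- The measure on the positive integers giving mass `2⁻ᵏ` to `k`. -/
def geometricHalfAux : Measure ℕ+ :=
  Measure.sum fun k : ℕ+ => ((2 : ℝ≥0∞)⁻¹ ^ (k : ℕ)) • Measure.dirac k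

instance instIsProbabilityMeasureGeometricHalfAux : IsProbabilityMeasure geometricHalfAux := by
  constructor
  rw [geometricHalfAux, Measure.sum_apply _ MeasurableSet.univ]
  simp only [Measure.smul_apply, measure_univ, smul_eq_mul, mul_one]
  rw [tsum_pnat_eq_tsum_succ (f := fun k : ℕ => (2 : ℝ≥0∞)⁻¹ ^ k)]
  rw [ENNReal.tsum_geometric_add_one, ENNReal.one_sub_inv_two, inv_inv]
  exact ENNReal.inv_mul_cancel two_ne_zero ENNReal.ofNat_ne_top

/-- The geometric distribution of parameter `1/2` on `{1, 2, 3, …}`. -/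
def geometricHalf : ProbabilityMeasure ℕ+ := ⟨geometricHalfAux, inferInstance⟩

/-- The mean `m₁(μ) ∈ [0, ∞]`. -/
def mean (μ : FiniteMeasure ℕ+) : ℝ≥0∞ := ∫⁻ k, ((k : ℕ) : ℝ≥0∞) ∂(μ : Measure ℕ+)

/-- The entropy `H(μ) = - ∑ₖ μₖ log μₖ`. It is only used for probability measures of finite mean,
for which this series of non-negative terms converges. -/
def entropy (μ : FiniteMeasure ℕ+) : ℝ := ∑' k : ℕ+, Real.negMulLog (μ {k} : ℝ)

open Classical in
/-- The rate function `J(m, μ, t)`. It is finite only if `μ` is a probability measure and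
`m₁(μ) = m = 1 / (2t)`; then `m ≥ 1`. For `m = 1` the formula is understood through its limiting
value `log 4`, and this is also what the convention `Real.log 0 = 0` gives. At `t = 0` the value
is `⊤`, because `m₁(μ) ≥ 1` excludes `m = 1 / 0 = 0`. -/
def rateFunction (m : ℝ) (μ : FiniteMeasure ℕ+) (t : Set.Icc (0 : ℝ) 1) : EReal :=
  if μ.mass = 1 ∧ mean μ = ENNReal.ofReal m ∧ m = 1 / (2 * (t : ℝ)) then
    ((Real.log 4 - 1 / m * entropy μ - 1 / m * Real.log (m - 1) + Real.log (1 - 1 / m) : ℝ) : EReal)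
  else ⊤

end

/-! Part (i) rests on a count. A partition π is encoded by the word `code π` of length n with the
block size at each block minimum and 0 elsewhere. For a non-crossing π the word determines π
(`code_injective`), since a point that is not a block minimum must join the most recently opened
block that is not yet exhausted. The letters of the word sum to n, so independent geometric letters
with weights 2^{-(j+1)}, j ≥ 0, give every such word the same probability 4^{-n}. A Chernoff bound
for these letters then bounds the number of words in which the frequency of a letter k is off by ε
by 2 · 4^n · exp(-ε²n/4) (`card_deviation_le`).

In the other direction, Dyck paths inject into NC(n), so |NC(n)| is at least the Catalan number,
hence at least 4^n / (2n(n+1)). Deviation probabilities under the uniform law are therefore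
summable, and the first Borel–Cantelli lemma, which needs no assumption on the joint law, gives
frequencies tending to 2^{-(k+1)}. The number of blocks is n minus the number of zeros, about n/2,
so the proportion of blocks of size k tends to 2^{-k}.

For part (ii), where J is finite and m > 1 it equals (1/m)(m log 2 - H(μ)) + (log 2 - h(1/m)), with
h the binary entropy. Both terms are nonnegative. The second vanishes only at m = 2, and the first
only at the geometric law, by the equality case of Gibbs' inequality. -/

/-! ### Encoding non-crossing partitions by words -/

namespace NC

variable {n : ℕ}

/-- The block of a non-crossing partition that contains a given point. -/
def block (π : NC n) (x : Fin n) : Finset (Fin n) := π.1.part x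

theorem block_mem_parts (π : NC n) (x : Fin n) : π.block x ∈ π.1.parts :=
  π.1.part_mem.2 (Finset.mem_univ x)

theorem self_mem_block (π : NC n) (x : Fin n) : x ∈ π.block x :=
  π.1.mem_part (Finset.mem_univ x)

theorem mem_block_iff (π : NC n) (x y : Fin n) : x ∈ π.block y ↔ π.block x = π.block y :=
  π.1.mem_part_iff_part_eq_part (Finset.mem_univ x) (Finset.mem_univ y)

theorem block_eq_of_mem (π : NC n) {V : Finset (Fin n)} (hV : V ∈ π.1.parts) {x : Fin n}
    (hx : x ∈ V) : π.block x = V :=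
  π.1.part_eq_of_mem hV hx

theorem ext_block {π ρ : NC n} (h : ∀ x, π.block x = ρ.block x) : π = ρ := by
  apply Subtype.ext
  apply Finpartition.ext
  ext V
  constructor <;> intro hV
  · obtain ⟨x, hx⟩ := π.1.nonempty_of_mem_parts hV
    rw [← π.block_eq_of_mem hV hx, h]
    exact ρ.block_mem_parts x
  · obtain ⟨x, hx⟩ := ρ.1.nonempty_of_mem_parts hV
    rw [← ρ.block_eq_of_mem hV hx, ← h]
    exact π.block_mem_parts x

theorem block_eq_of_crossing (π : NC n) {a b c d : Fin n} (hab : a < b) (hbc : b < c) (hcd : c < d)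
    (hac : π.block a = π.block c) (hbd : π.block b = π.block d) : π.block a = π.block b := by
  by_contra hne
  exact π.2 _ (π.block_mem_parts a) _ (π.block_mem_parts b) hne
    ⟨a, π.self_mem_block a, c, (π.mem_block_iff c a).2 hac.symm, b, π.self_mem_block b, d,
      (π.mem_block_iff d b).2 hbd.symm, hab, hbc, hcd⟩

/-- The least element of the block of a given point. -/
def blockMin (π : NC n) (x : Fin n) : Fin n := (π.block x).min' ⟨x, π.self_mem_block x⟩

theorem blockMin_le (π : NC n) (x : Fin n) : π.blockMin x ≤ x :=
  Finset.min'_le _ _ (π.self_mem_block x)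

theorem blockMin_mem (π : NC n) (x : Fin n) : π.blockMin x ∈ π.block x := Finset.min'_mem _ _

theorem block_blockMin (π : NC n) (x : Fin n) : π.block (π.blockMin x) = π.block x :=
  (π.mem_block_iff _ _).1 (π.blockMin_mem x)

theorem blockMin_eq_iff (π : NC n) (x y : Fin n) :
    π.blockMin x = π.blockMin y ↔ π.block x = π.block y := by
  refine ⟨fun h => ?_, fun h => ?_⟩
  · rw [← block_blockMin, h, block_blockMin]
  · simp only [blockMin, h]

theorem blockMin_blockMin (π : NC n) (x : Fin n) : π.blockMin (π.blockMin x) = π.blockMin x :=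
  (π.blockMin_eq_iff _ _).2 (π.block_blockMin x)

theorem block_eq_filter (π : NC n) (x : Fin n) :
    π.block x = Finset.univ.filter fun y => π.blockMin y = π.blockMin x := by
  ext y
  simp [mem_block_iff, blockMin_eq_iff]

/-- The word that records the size of a block at its least element, and `0` elsewhere. -/
def code (π : NC n) (i : Fin n) : ℕ := if π.blockMin i = i then (π.block i).card else 0

theorem card_block_pos (π : NC n) (i : Fin n) : 0 < (π.block i).card :=
  Finset.card_pos.2 ⟨i, π.self_mem_block i⟩

theorem code_ne_zero_iff (π : NC n) (i : Fin n) : π.code i ≠ 0 ↔ π.blockMin i = i := by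
  unfold code
  split_ifs with h <;> simp [h, (π.card_block_pos i).ne']

/-- The least elements of those blocks that start before `x` and are not exhausted before `x`. -/
def openBefore (π : NC n) (x : Fin n) : Finset (Fin n) :=
  Finset.univ.filter fun i => i < x ∧ π.code i ≠ 0 ∧
    (Finset.univ.filter fun y => y < x ∧ π.blockMin y = i).card < π.code i

/-- The point `x` lies in its block but not before `x`, so that block is not exhausted. With the
next lemma, `blockMin x` is the largest element of `openBefore x` whenever `x` is not itself a
minimum. -/
theorem blockMin_mem_openBefore (π : NC n) {x : Fin n} (hx : π.blockMin x ≠ x) :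
    π.blockMin x ∈ π.openBefore x := by
  simp only [openBefore, Finset.mem_filter, Finset.mem_univ, true_and]
  refine ⟨lt_of_le_of_ne (π.blockMin_le x) hx, (π.code_ne_zero_iff _).2 (π.blockMin_blockMin x), ?_⟩
  rw [code, if_pos (π.blockMin_blockMin x), block_blockMin]
  apply Finset.card_lt_card
  rw [block_eq_filter, Finset.ssubset_iff_of_subset
    (Finset.monotone_filter_right _ fun y _ h => h.2)]
  exact ⟨x, by simp, by simp⟩

/-- A block open before `x` has an element `y ≥ x`. If it started strictly after `blockMin x`, then
`y ≠ x` and `blockMin x < i < x < y` would be a crossing. -/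
theorem le_blockMin_of_mem_openBefore (π : NC n) {x i : Fin n} (hi : i ∈ π.openBefore x) :
    i ≤ π.blockMin x := by
  simp only [openBefore, Finset.mem_filter, Finset.mem_univ, true_and, code_ne_zero_iff] at hi
  obtain ⟨hix, hmin, hcard⟩ := hi
  rw [code, if_pos hmin] at hcard
  obtain ⟨y, hy, hy'⟩ := Finset.exists_mem_notMem_of_card_lt_card hcard
  rw [block_eq_filter, Finset.mem_filter, hmin] at hy
  have hxy : x ≤ y := by
    by_contra! h
    exact hy' (by simp [h, hy.2])
  rcases hxy.eq_or_lt with rfl | hxy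
  · exact hy.2.ge
  · by_contra! hlt
    have h := π.block_eq_of_crossing hlt hix hxy (π.block_blockMin x)
      ((π.blockMin_eq_iff _ _).1 (hmin.trans hy.2.symm))
    rw [← blockMin_eq_iff, blockMin_blockMin, hmin] at h
    exact hlt.ne h

/-- Strong induction on the point: `openBefore x` depends only on the code and on the block minima
of points below `x`, and it determines `blockMin x`. -/
theorem code_injective : Function.Injective (code (n := n)) := by
  intro π ρ h
  have key : ∀ x, π.blockMin x = ρ.blockMin x := by
    intro x
    induction x using WellFoundedLT.induction with
    | ind x ih =>
      by_cases hx : π.blockMin x = x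
      · rw [hx, eq_comm, ← code_ne_zero_iff, ← h, code_ne_zero_iff, hx]
      · have hx' : ρ.blockMin x ≠ x := by
          rwa [Ne, ← code_ne_zero_iff, ← h, code_ne_zero_iff]
        have hopen : π.openBefore x = ρ.openBefore x := by
          unfold openBefore
          ext i
          simp only [h, Finset.mem_filter]
          have : ∀ y, (y < x ∧ π.blockMin y = i) ↔ (y < x ∧ ρ.blockMin y = i) :=
            fun y => and_congr_right fun hy => by rw [ih y hy]
          simp only [this]
        apply le_antisymm
        · exact ρ.le_blockMin_of_mem_openBefore (hopen ▸ π.blockMin_mem_openBefore hx)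
        · exact π.le_blockMin_of_mem_openBefore (hopen ▸ ρ.blockMin_mem_openBefore hx')
  refine ext_block fun x => ?_
  simp only [block_eq_filter, key]

theorem sum_blockMin_eq_sum_parts (π : NC n) (f : Finset (Fin n) → ℕ) :
    (∑ i, if π.blockMin i = i then f (π.block i) else 0) = ∑ V ∈ π.1.parts, f V := by
  rw [← Finset.sum_filter]
  refine Finset.sum_bij (fun i _ => π.block i) (fun i _ => π.block_mem_parts i) ?_ ?_
    fun _ _ => rfl
  · intro i hi j hj hij
    simp only [Finset.mem_filter, Finset.mem_univ, true_and] at hi hj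
    rw [← blockMin_eq_iff, hi, hj] at hij
    exact hij
  · intro V hV
    obtain ⟨x, hx⟩ := π.1.nonempty_of_mem_parts hV
    exact ⟨π.blockMin x, by simp [blockMin_blockMin],
      by rw [block_blockMin, π.block_eq_of_mem hV hx]⟩

theorem sum_code (π : NC n) : ∑ i, π.code i = n := by
  simp only [code]
  rw [π.sum_blockMin_eq_sum_parts Finset.card, π.1.sum_card_parts, Finset.card_fin]

theorem card_filter_code_eq (π : NC n) {k : ℕ} (hk : k ≠ 0) :
    (Finset.univ.filter fun i => π.code i = k).card =
      (π.1.parts.filter fun V => V.card = k).card := by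
  rw [Finset.card_filter, Finset.card_filter,
    ← π.sum_blockMin_eq_sum_parts fun V => if V.card = k then 1 else 0]
  refine Finset.sum_congr rfl fun i _ => ?_
  unfold code
  split_ifs <;> simp_all

theorem card_filter_code_eq_zero (π : NC n) :
    (Finset.univ.filter fun i => π.code i = 0).card + π.1.parts.card = n := by
  have h : π.1.parts.card = (Finset.univ.filter fun i => ¬ π.code i = 0).card := by
    rw [Finset.card_eq_sum_ones, ← π.sum_blockMin_eq_sum_parts fun _ => 1, Finset.card_filter]
    simp only [← ne_eq, code_ne_zero_iff]
  rw [h, Finset.card_filter_add_card_filter_not, Finset.card_fin]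

end NC

/-! ### Catalan lower bound for the number of non-crossing partitions -/

/-- Two odd times `2i + 1`, `2j + 1` are related if the function `h` takes the same value there and
does not go below this value in between. -/
def oddLevelSetoid (n : ℕ) (h : ℕ → ℤ) : Setoid (Fin n) where
  r i j := h (2 * i + 1) = h (2 * j + 1) ∧
    ∀ t ∈ Set.uIcc (2 * (i : ℕ) + 1) (2 * j + 1), h (2 * i + 1) ≤ h t
  iseqv :=
    { refl := fun i => ⟨rfl, fun t ht => by
        rw [Set.uIcc_self, Set.mem_singleton_iff] at ht
        rw [ht]⟩
      symm := fun {i j} hij => ⟨hij.1.symm, fun t ht => by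
        rw [Set.uIcc_comm] at ht
        exact hij.1 ▸ hij.2 t ht⟩
      trans := fun {i j k} hij hjk => ⟨hij.1.trans hjk.1, fun t ht => by
        rcases Set.uIcc_subset_uIcc_union_uIcc (b := 2 * (j : ℕ) + 1) ht with h' | h'
        · exact hij.2 t h'
        · exact hij.1 ▸ hjk.2 t h'⟩ }

open Classical in
theorem isNonCrossing_ofSetoid_oddLevelSetoid (n : ℕ) (h : ℕ → ℤ) :
    IsNonCrossing (Finpartition.ofSetoid (oddLevelSetoid n h)) := by
  rintro V₁ h₁ V₂ h₂ hne ⟨x₁, hx₁, y₁, hy₁, x₂, hx₂, y₂, hy₂, hlt₁, hlt₂, hlt₃⟩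
  have e₁ := Finpartition.part_eq_of_mem _ h₁ hx₁
  have e₂ := Finpartition.part_eq_of_mem _ h₂ hx₂
  rw [← e₁, Finpartition.mem_part_ofSetoid_iff_rel] at hy₁
  rw [← e₂, Finpartition.mem_part_ofSetoid_iff_rel] at hy₂
  refine hne ((Finpartition.part_eq_of_mem _ h₁ ?_).symm.trans e₂)
  rw [← e₁, Finpartition.mem_part_ofSetoid_iff_rel]
  rw [Fin.lt_def] at hlt₁ hlt₂ hlt₃
  -- Each of the two middle points lies between two related times, so all four levels agree. The
  -- interval from `x₁` to `x₂` is contained in the one from `x₁` to `y₁`.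
  have ha : h (2 * x₁ + 1) ≤ h (2 * x₂ + 1) :=
    hy₁.2 _ (Set.mem_uIcc.2 (Or.inl ⟨by omega, by omega⟩))
  have hb : h (2 * x₂ + 1) ≤ h (2 * y₁ + 1) :=
    hy₂.2 _ (Set.mem_uIcc.2 (Or.inl ⟨by omega, by omega⟩))
  refine ⟨le_antisymm ha (hb.trans hy₁.1.ge), fun t ht => hy₁.2 t ?_⟩
  rw [Set.mem_uIcc] at ht ⊢
  omega

open Classical in
/-- The non-crossing partition given by the odd levels of an integer-valued function. -/
noncomputable def NC.ofHeight (n : ℕ) (h : ℕ → ℤ) : NC n :=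
  ⟨Finpartition.ofSetoid (oddLevelSetoid n h), isNonCrossing_ofSetoid_oddLevelSetoid n h⟩

theorem NC.oddLevelSetoid_eq_of_ofHeight_eq {n : ℕ} {h h' : ℕ → ℤ}
    (e : NC.ofHeight n h = NC.ofHeight n h') : oddLevelSetoid n h = oddLevelSetoid n h' := by
  classical
  have e' := congrArg Subtype.val e
  ext i j
  rw [← Finpartition.mem_part_ofSetoid_iff_rel, ← Finpartition.mem_part_ofSetoid_iff_rel]
  exact iff_of_eq (congrArg (fun P : Finpartition Finset.univ => j ∈ P.part i) e')

/-- The height functions of Dyck paths with `2n` steps. -/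
structure IsDyckPath (n : ℕ) (h : ℕ → ℤ) : Prop where
  zero : h 0 = 0
  last : h (2 * n) = 0
  nonneg : ∀ t, 0 ≤ h t
  step : ∀ t < 2 * n, h (t + 1) = h t + 1 ∨ h (t + 1) = h t - 1

namespace IsDyckPath

variable {n : ℕ} {h : ℕ → ℤ}

theorem emod_two (H : IsDyckPath n h) {t : ℕ} (ht : t ≤ 2 * n) : h t % 2 = (t : ℤ) % 2 := by
  induction t with
  | zero => simp [H.zero]
  | succ t ih =>
    have := ih (by omega)
    have := H.step t (by omega)
    push_cast
    omega

theorem odd_pos (H : IsDyckPath n h) {i : ℕ} (hi : i < n) : 1 ≤ h (2 * i + 1) := by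
  have h₁ := H.emod_two (t := 2 * i + 1) (by omega)
  have h₂ := H.nonneg (2 * i + 1)
  omega

/-- After an up-step at time `2i + 1` the path must come back, as it ends at height 0 and `h (2i +
1) ≥ 1`. The first later time at or below the old level is at exactly that level, since steps are
±1, and is odd by parity. After a down-step the path is already below the level, so no later time is
related. -/
theorem up_iff_exists_gt (H : IsDyckPath n h) (i : Fin n) :
    h (2 * i + 1 + 1) = h (2 * i + 1) + 1 ↔ ∃ j, i < j ∧ oddLevelSetoid n h i j := by
  have hi := i.2
  constructor
  · intro hup
    have hpos := H.odd_pos i.2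
    have hex : ∃ t, 2 * (i : ℕ) + 1 < t ∧ h t ≤ h (2 * i + 1) :=
      ⟨2 * n, by omega, by rw [H.last]; omega⟩
    classical
    obtain ⟨hlt, hle⟩ := Nat.find_spec hex
    have hmin : ∀ s < Nat.find hex, 2 * (i : ℕ) + 1 < s → h (2 * i + 1) < h s := fun s hs hs' => by
      have := Nat.find_min hex hs
      push Not at this
      exact this hs'
    have htn : Nat.find hex ≤ 2 * n := Nat.find_min' hex ⟨by omega, by rw [H.last]; omega⟩
    generalize Nat.find hex = t at hlt hle hmin htn
    have hne : t ≠ 2 * (i : ℕ) + 1 + 1 := by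
      rintro rfl
      omega
    have hs := H.step (t - 1) (by omega)
    rw [Nat.sub_add_cancel (by omega)] at hs
    have hprev := hmin (t - 1) (by omega) (by omega)
    have heq : h t = h (2 * i + 1) := by omega
    have p₁ := H.emod_two htn
    have p₂ := H.emod_two (t := 2 * i + 1) (by omega)
    obtain ⟨j, rfl⟩ : ∃ j, t = 2 * j + 1 := ⟨t / 2, by push_cast at p₂; omega⟩
    refine ⟨⟨j, by omega⟩, by rw [Fin.lt_def]; dsimp only; omega, heq.symm, fun s hs => ?_⟩
    rw [Set.mem_uIcc] at hs
    dsimp only at hs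
    rcases Nat.lt_or_ge (2 * (i : ℕ) + 1) s with h₁ | h₁
    · rcases Nat.lt_or_ge s (2 * j + 1) with h₂ | h₂
      · exact (hmin s h₂ h₁).le
      · rw [show s = 2 * j + 1 by omega, heq]
    · rw [show s = 2 * (i : ℕ) + 1 by omega]
  · rintro ⟨j, hij, -, hj⟩
    rw [Fin.lt_def] at hij
    have h₁ := hj (2 * i + 1 + 1) (Set.mem_uIcc.2 (Or.inl ⟨by omega, by omega⟩))
    have h₂ := H.step (2 * i + 1) (by omega)
    omega

/-- The time reversal of the previous lemma: the last time up to `2i` at or below the level `h (2i +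
1)` plays the role of the first return, and time 0 shows that such a time exists. -/
theorem down_iff_exists_lt (H : IsDyckPath n h) (i : Fin n) :
    h (2 * i + 1) = h (2 * i) - 1 ↔ ∃ j, j < i ∧ oddLevelSetoid n h i j := by
  have hi := i.2
  constructor
  · intro hdown
    have hpos := H.odd_pos i.2
    have hP : h 0 ≤ h (2 * i + 1) := by rw [H.zero]; omega
    have hle := Nat.findGreatest_spec (P := fun t => h t ≤ h (2 * i + 1)) (Nat.zero_le (2 * i)) hP
    have hlt := Nat.findGreatest_le (P := fun t => h t ≤ h (2 * i + 1)) (2 * i)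
    have hmax : ∀ s, Nat.findGreatest (fun t => h t ≤ h (2 * i + 1)) (2 * i) < s → s ≤ 2 * i →
        h (2 * i + 1) < h s := fun s h₁ h₂ => by
      simpa using Nat.findGreatest_is_greatest h₁ h₂
    generalize Nat.findGreatest (fun t => h t ≤ h (2 * i + 1)) (2 * i) = t at hle hlt hmax
    have hne : t ≠ 2 * (i : ℕ) := by
      rintro rfl
      omega
    have hs := H.step t (by omega)
    have hnext := hmax (t + 1) (by omega) (by omega)
    have heq : h t = h (2 * i + 1) := by omega
    have p₁ := H.emod_two (t := t) (by omega)
    have p₂ := H.emod_two (t := 2 * i + 1) (by omega)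
    obtain ⟨j, rfl⟩ : ∃ j, t = 2 * j + 1 := ⟨t / 2, by push_cast at p₂; omega⟩
    refine ⟨⟨j, by omega⟩, by rw [Fin.lt_def]; dsimp only; omega, heq.symm, fun s hs => ?_⟩
    rw [Set.mem_uIcc] at hs
    dsimp only at hs
    rcases Nat.lt_or_ge (2 * j + 1) s with h₁ | h₁
    · rcases Nat.lt_or_ge s (2 * (i : ℕ) + 1) with h₂ | h₂
      · exact (hmax s h₁ (by omega)).le
      · rw [show s = 2 * (i : ℕ) + 1 by omega]
    · rw [show s = 2 * j + 1 by omega, heq]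
  · rintro ⟨j, hij, -, hj⟩
    rw [Fin.lt_def] at hij
    have h₁ := hj (2 * i) (Set.mem_uIcc.2 (Or.inr ⟨by omega, by omega⟩))
    have h₂ := H.step (2 * i) (by omega)
    omega

/-- The relation recovers the path: steps from odd times are read off from later related points, and
steps from even times from earlier ones. -/
theorem up_iff_of_oddLevelSetoid_eq {h' : ℕ → ℤ} (H : IsDyckPath n h) (H' : IsDyckPath n h')
    (e : oddLevelSetoid n h = oddLevelSetoid n h') {t : ℕ} (ht : t < 2 * n) :
    h (t + 1) = h t + 1 ↔ h' (t + 1) = h' t + 1 := by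
  rcases Nat.even_or_odd' t with ⟨i, rfl | rfl⟩
  · have h₁ := H.down_iff_exists_lt ⟨i, by omega⟩
    have h₂ := H'.down_iff_exists_lt ⟨i, by omega⟩
    rw [e, ← h₂] at h₁
    have h₃ := H.step _ ht
    have h₄ := H'.step _ ht
    change h (2 * i + 1) = h (2 * i) - 1 ↔ h' (2 * i + 1) = h' (2 * i) - 1 at h₁
    clear e
    omega
  · have h₁ := H.up_iff_exists_gt ⟨i, by omega⟩
    have h₂ := H'.up_iff_exists_gt ⟨i, by omega⟩
    rw [e, ← h₂] at h₁
    exact h₁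

end IsDyckPath

namespace DyckWord

/-- The height of a Dyck word after `t` steps. -/
def height (p : DyckWord) (t : ℕ) : ℤ :=
  (p.toList.take t).count DyckStep.U - (p.toList.take t).count DyckStep.D

theorem height_succ (p : DyckWord) {t : ℕ} (ht : t < p.toList.length) :
    p.height (t + 1) = p.height t + if p.toList[t] = DyckStep.U then 1 else -1 := by
  unfold height
  rw [List.take_add_one, List.getElem?_eq_getElem ht]
  simp only [Option.toList_some, List.count_append, List.count_singleton]
  rcases p.toList[t].dichotomy with h | h <;> simp [h] <;> ring

theorem isDyckPath_height {n : ℕ} (p : DyckWord) (hp : p.semilength = n) :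
    IsDyckPath n p.height where
  zero := by simp [height]
  last := by
    rw [height, ← hp, two_mul_semilength_eq_length, List.take_length, p.count_U_eq_count_D, sub_self]
  nonneg t := by
    have := p.count_D_le_count_U t
    unfold height
    omega
  step t ht := by
    rw [← hp, two_mul_semilength_eq_length] at ht
    rw [p.height_succ ht]
    split_ifs
    · exact Or.inl rfl
    · exact Or.inr rfl

theorem ofHeight_height_injective (n : ℕ) :
    Function.Injective fun p : {p : DyckWord // p.semilength = n} =>
      NC.ofHeight n p.1.height := by
  rintro ⟨p, hp⟩ ⟨q, hq⟩ e
  have e' := NC.oddLevelSetoid_eq_of_ofHeight_eq e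
  have lp := p.two_mul_semilength_eq_length
  have lq := q.two_mul_semilength_eq_length
  refine Subtype.ext (DyckWord.ext (List.ext_getElem ?_ fun t h₁ h₂ => ?_))
  · dsimp only
    omega
  dsimp only at h₁ h₂
  have h := (p.isDyckPath_height hp).up_iff_of_oddLevelSetoid_eq (q.isDyckPath_height hq) e'
    (t := t) (by omega)
  rw [height_succ p h₁, height_succ q h₂] at h
  dsimp only
  rcases p.toList[t].dichotomy with hpt | hpt <;> rcases q.toList[t].dichotomy with hqt | hqt <;>
    rw [hpt, hqt] at h ⊢ <;> simp at h

end DyckWord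

theorem catalan_le_card_NC (n : ℕ) : catalan n ≤ Nat.card (NC n) := by
  rw [← DyckWord.card_dyckWord_semilength_eq_catalan, ← Nat.card_eq_fintype_card]
  exact Nat.card_le_card_of_injective _ (DyckWord.ofHeight_height_injective n)

theorem four_pow_le_mul_card_NC {n : ℕ} (hn : 0 < n) :
    4 ^ n ≤ 2 * n * (n + 1) * Nat.card (NC n) := by
  refine (Nat.four_pow_le_two_mul_self_mul_centralBinom n hn).trans ?_
  rw [← succ_mul_catalan_eq_centralBinom, mul_assoc (2 * n)]
  gcongr
  exact catalan_le_card_NC n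

/-! ### Chernoff bound for letter counts -/

theorem Real.exp_le_one_add_add_sq {x : ℝ} (hx : |x| ≤ 1) : Real.exp x ≤ 1 + x + x ^ 2 := by
  have := (abs_le.1 (Real.abs_exp_sub_one_sub_id_le hx)).2
  linarith

/-- The weights of a geometric distribution, exponentially tilted at one point. -/
theorem sum_geometric_tilted_le (k M : ℕ) (hk : k < M) {θ : ℝ} (hθ : |θ| ≤ 1) :
    ∑ j ∈ Finset.range M, (1 / 2 : ℝ) ^ (j + 1) * Real.exp (if j = k then θ else 0) ≤
      Real.exp ((1 / 2) ^ (k + 1) * θ + θ ^ 2) := by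
  have h₁ : ∀ j, (1 / 2 : ℝ) ^ (j + 1) * Real.exp (if j = k then θ else 0) =
      (1 / 2) ^ j * (1 / 2) + if j = k then (1 / 2) ^ (j + 1) * (Real.exp θ - 1) else 0 := by
    intro j
    split_ifs <;> simp <;> ring
  simp only [h₁]
  rw [Finset.sum_add_distrib, ← Finset.sum_mul, geom_sum_eq (by norm_num), Finset.sum_ite_eq',
    if_pos (Finset.mem_range.2 hk)]
  have hp : (0 : ℝ) < (1 / 2) ^ (k + 1) := by positivity
  have hp' : (1 / 2 : ℝ) ^ (k + 1) ≤ 1 := pow_le_one₀ (by norm_num) (by norm_num)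
  have hM : (0 : ℝ) < (1 / 2) ^ M := by positivity
  have he := Real.exp_le_one_add_add_sq hθ
  have h₂ : (1 / 2 : ℝ) ^ (k + 1) * (Real.exp θ - 1) ≤ (1 / 2) ^ (k + 1) * (θ + θ ^ 2) := by
    gcongr
    linarith
  have h₃ : (1 / 2 : ℝ) ^ (k + 1) * θ ^ 2 ≤ θ ^ 2 := mul_le_of_le_one_left (sq_nonneg _) hp'
  have h₄ := Real.add_one_le_exp ((1 / 2 : ℝ) ^ (k + 1) * θ + θ ^ 2)
  -- The truncated weights have mass `1 - 2^{-M}`; the missing mass only helps the upper bound.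
  have h₅ : ((1 / 2 : ℝ) ^ M - 1) / (1 / 2 - 1) * (1 / 2) = 1 - (1 / 2) ^ M := by ring
  rw [h₅]
  linarith

/-- The number of occurrences of a letter in a word. -/
def letterCount {n : ℕ} (s : Fin n → ℕ) (k : ℕ) : ℕ := (Finset.univ.filter fun i => s i = k).card

/-- Exponential Markov inequality. The product weight of a word of sum n is `4^{-n} exp(θ · count)`,
because the exponents `s i + 1` add up to 2n. After normalisation every word of `S` weighs at least
1, while the total weight of all words factorises over the letters. -/
theorem card_le_of_tilt {n k : ℕ} {θ c : ℝ} (hθ : |θ| ≤ 1) (S : Finset (Fin n → ℕ))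
    (hsum : ∀ s ∈ S, ∑ i, s i = n)
    (hdev : ∀ s ∈ S, n * c ≤ θ * (letterCount s k - n * (1 / 2) ^ (k + 1))) :
    (S.card : ℝ) ≤ 4 ^ n * Real.exp (n * (θ ^ 2 - c)) := by
  set p : ℝ := (1 / 2) ^ (k + 1) with hp
  set g : ℕ → ℝ := fun j => (1 / 2 : ℝ) ^ (j + 1) * Real.exp (if j = k then θ else 0) with hg
  have hg0 : ∀ j, 0 ≤ g j := fun j => by positivity
  have hprod : ∀ s ∈ S, ∏ i, g (s i) = (4 ^ n)⁻¹ * Real.exp (θ * letterCount s k) := by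
    intro s hs
    simp only [hg]
    rw [Finset.prod_mul_distrib, Finset.prod_pow_eq_pow_sum, ← Real.exp_sum,
      Finset.sum_add_distrib, hsum s hs, ← Finset.sum_filter]
    simp only [Finset.sum_const, Finset.card_fin, smul_eq_mul, mul_one, nsmul_eq_mul]
    rw [← two_mul, pow_mul, letterCount, mul_comm θ, ← inv_pow]
    norm_num
  have hone : ∀ s ∈ S, (1 : ℝ) ≤ 4 ^ n * Real.exp (-(n * (p * θ + c))) * ∏ i, g (s i) := by
    intro s hs
    rw [hprod s hs]
    have h₁ : (4 : ℝ) ^ n * Real.exp (-(n * (p * θ + c))) *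
        ((4 ^ n)⁻¹ * Real.exp (θ * letterCount s k)) =
        Real.exp (-(n * (p * θ + c)) + θ * letterCount s k) := by
      rw [Real.exp_add]
      field_simp
    rw [h₁, Real.one_le_exp_iff]
    have := hdev s hs
    linarith
  -- The letters are at most n because they sum to n; adding `k` to the bound keeps the tilted
  -- letter inside the range.
  have hsub : S ⊆ Fintype.piFinset fun _ : Fin n => Finset.range (n + k + 1) := by
    intro s hs
    rw [Fintype.mem_piFinset]
    intro i
    have := Finset.single_le_sum (f := s) (fun _ _ => Nat.zero_le _) (Finset.mem_univ i)
    rw [hsum s hs] at this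
    exact Finset.mem_range.2 (by omega)
  calc (S.card : ℝ) = ∑ s ∈ S, 1 := by simp
    _ ≤ ∑ s ∈ S, 4 ^ n * Real.exp (-(n * (p * θ + c))) * ∏ i, g (s i) := Finset.sum_le_sum hone
    _ = 4 ^ n * Real.exp (-(n * (p * θ + c))) * ∑ s ∈ S, ∏ i, g (s i) := by rw [Finset.mul_sum]
    _ ≤ 4 ^ n * Real.exp (-(n * (p * θ + c))) *
        ∑ s ∈ Fintype.piFinset fun _ : Fin n => Finset.range (n + k + 1), ∏ i, g (s i) := by
      gcongr
    _ = 4 ^ n * Real.exp (-(n * (p * θ + c))) * (∑ j ∈ Finset.range (n + k + 1), g j) ^ n := by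
      rw [Finset.sum_prod_piFinset (Finset.range (n + k + 1)) fun _ j => g j]
      simp
    _ ≤ 4 ^ n * Real.exp (-(n * (p * θ + c))) * Real.exp (p * θ + θ ^ 2) ^ n := by
      gcongr
      exact sum_geometric_tilted_le k _ (by omega) hθ
    _ = 4 ^ n * Real.exp (n * (θ ^ 2 - c)) := by
      rw [← Real.exp_nat_mul, mul_assoc, ← Real.exp_add]
      ring_nf

theorem card_deviation_le {n k : ℕ} {ε : ℝ} (hε : 0 < ε) (hε' : ε ≤ 1) (S : Finset (Fin n → ℕ))
    (hsum : ∀ s ∈ S, ∑ i, s i = n)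
    (hdev : ∀ s ∈ S, n * ε ≤ |letterCount s k - n * (1 / 2 : ℝ) ^ (k + 1)|) :
    (S.card : ℝ) ≤ 2 * (4 ^ n * Real.exp (-(ε ^ 2 / 4) * n)) := by
  classical
  rw [← Finset.card_filter_add_card_filter_not
    (p := fun s => n * ε ≤ letterCount s k - n * (1 / 2 : ℝ) ^ (k + 1)), Nat.cast_add]
  -- With `c = θε` the exponent `θ² - θε` is minimal at `θ = ε / 2`, where it equals `-ε² / 4`. The
  -- lower tail uses `-θ`.
  have h₁ := card_le_of_tilt (n := n) (k := k) (θ := ε / 2) (c := ε ^ 2 / 2)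
    (abs_le.2 ⟨by linarith, by linarith⟩)
    (S.filter fun s => n * ε ≤ letterCount s k - n * (1 / 2 : ℝ) ^ (k + 1))
    (fun s hs => hsum s (Finset.mem_filter.1 hs).1) fun s hs => by
      have := mul_le_mul_of_nonneg_left (Finset.mem_filter.1 hs).2 (half_pos hε).le
      linarith
  have h₂ := card_le_of_tilt (n := n) (k := k) (θ := -(ε / 2)) (c := ε ^ 2 / 2)
    (abs_le.2 ⟨by linarith, by linarith⟩)
    (S.filter fun s => ¬ n * ε ≤ letterCount s k - n * (1 / 2 : ℝ) ^ (k + 1))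
    (fun s hs => hsum s (Finset.mem_filter.1 hs).1) fun s hs => by
      rw [Finset.mem_filter] at hs
      have h := (le_abs.1 (hdev s hs.1)).resolve_left hs.2
      have := mul_le_mul_of_nonneg_left h (half_pos hε).le
      linarith
  have e₁ : n * ((ε / 2) ^ 2 - ε ^ 2 / 2) = -(ε ^ 2 / 4) * n := by ring
  have e₂ : n * ((-(ε / 2)) ^ 2 - ε ^ 2 / 2) = -(ε ^ 2 / 4) * n := by ring
  rw [e₁] at h₁
  rw [e₂] at h₂
  linarith

theorem uniformNC_deviation_le {n k : ℕ} (hn : 0 < n) {ε : ℝ} (hε : 0 < ε) (hε' : ε ≤ 1) :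
    uniformNC n {π | n * ε ≤ |letterCount π.code k - n * (1 / 2 : ℝ) ^ (k + 1)|} ≤
      ENNReal.ofReal (4 * n * (n + 1) * Real.exp (-(ε ^ 2 / 4) * n)) := by
  classical
  have := Fintype.ofFinite (NC n)
  set A : Finset (NC n) := Finset.univ.filter fun π =>
    n * ε ≤ |letterCount π.code k - n * (1 / 2 : ℝ) ^ (k + 1)| with hA
  have hA' : {π : NC n | n * ε ≤ |letterCount π.code k - n * (1 / 2 : ℝ) ^ (k + 1)|} = A := by
    ext π
    simp [hA]
  have hcard := card_deviation_le (n := n) (k := k) hε hε' (A.image NC.code)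
    (by
      intro s hs
      obtain ⟨π, -, rfl⟩ := Finset.mem_image.1 hs
      exact π.sum_code)
    (by
      intro s hs
      obtain ⟨π, hπ, rfl⟩ := Finset.mem_image.1 hs
      exact (Finset.mem_filter.1 hπ).2)
  rw [Finset.card_image_of_injective _ NC.code_injective] at hcard
  have hfour : (4 : ℝ) ^ n ≤ 2 * n * (n + 1) * Fintype.card (NC n) := by
    rw [← Nat.card_eq_fintype_card]
    exact_mod_cast four_pow_le_mul_card_NC hn
  have hpos : (0 : ℝ) < Fintype.card (NC n) := by exact_mod_cast Fintype.card_pos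
  rw [hA', uniformNC, uniformOn_univ, Measure.count_apply_finset, ← ENNReal.ofReal_natCast,
    ← ENNReal.ofReal_natCast, ← ENNReal.ofReal_div_of_pos hpos]
  apply ENNReal.ofReal_le_ofReal
  rw [div_le_iff₀ hpos]
  calc (A.card : ℝ) ≤ 2 * (4 ^ n * Real.exp (-(ε ^ 2 / 4) * n)) := hcard
    _ ≤ 2 * (2 * n * (n + 1) * Fintype.card (NC n) * Real.exp (-(ε ^ 2 / 4) * n)) := by gcongr
    _ = _ := by ring

/-! ### Gibbs' inequality and the zero of the rate function -/

theorem geometricHalfAux_singleton (k : ℕ+) : geometricHalfAux {k} = (2 : ℝ≥0∞)⁻¹ ^ (k : ℕ) := by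
  rw [geometricHalfAux, Measure.sum_apply _ (measurableSet_singleton k), tsum_eq_single k]
  · simp
  · intro j hj
    simp [hj]

theorem geometricHalf_toFiniteMeasure_singleton (k : ℕ+) :
    ((geometricHalf.toFiniteMeasure {k} : ℝ≥0) : ℝ) = (1 / 2) ^ (k : ℕ) := by
  change (geometricHalfAux {k}).toReal = _
  rw [geometricHalfAux_singleton]
  simp

theorem hasSum_half_pow_pnat : HasSum (fun k : ℕ+ => (1 / 2 : ℝ) ^ (k : ℕ)) 1 := by
  rw [← Equiv.pnatEquivNat.symm.hasSum_iff]
  convert! hasSum_geometric_two.mul_left (1 / 2 : ℝ) using 1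
  · ext n
    simp [pow_succ, mul_comm]
  · norm_num

theorem hasSum_mul_half_pow_pnat :
    HasSum (fun k : ℕ+ => ((k : ℕ) : ℝ) * (1 / 2 : ℝ) ^ (k : ℕ)) 2 := by
  have h := hasSum_coe_mul_geometric_of_norm_lt_one (r := (1 / 2 : ℝ)) (by norm_num)
  rw [← Function.Injective.hasSum_iff PNat.coe_injective] at h
  · convert! h using 1
    norm_num
  · intro k hk
    have : k = 0 := by
      by_contra h0
      exact hk ⟨⟨k, Nat.pos_of_ne_zero h0⟩, rfl⟩
    simp [this]

/-- The pointwise Gibbs inequality. -/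
theorem negMulLog_le_sub_sub_mul_log {p q : ℝ} (hp : 0 ≤ p) (hq : 0 < q) :
    Real.negMulLog p ≤ q - p - p * Real.log q := by
  rcases hp.eq_or_lt with rfl | hp
  · simp [hq.le]
  · have h := Real.log_le_sub_one_of_pos (div_pos hq hp)
    rw [Real.log_div hq.ne' hp.ne'] at h
    have h' := mul_le_mul_of_nonneg_left h hp.le
    have e : p * (q / p - 1) = q - p := by field_simp
    rw [e] at h'
    unfold Real.negMulLog
    linarith

theorem eq_of_negMulLog_eq {p q : ℝ} (hp : 0 ≤ p) (hq : 0 < q)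
    (h : Real.negMulLog p = q - p - p * Real.log q) : p = q := by
  rcases hp.eq_or_lt with rfl | hp
  · simpa using h
  · by_contra hne
    have h₁ := Real.log_lt_sub_one_of_pos (div_pos hq hp) (by
      rw [Ne, div_eq_one_iff_eq hp.ne']
      exact fun h => hne h.symm)
    rw [Real.log_div hq.ne' hp.ne'] at h₁
    have h' := mul_lt_mul_of_pos_left h₁ hp
    have e : p * (q / p - 1) = q - p := by field_simp
    rw [e] at h'
    unfold Real.negMulLog at h
    linarith

theorem hasSum_measure_singleton {μ : FiniteMeasure ℕ+} (hμ : μ.mass = 1) :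
    HasSum (fun k : ℕ+ => (μ {k} : ℝ)) 1 := by
  have h := Measure.tsum_indicator_apply_singleton (μ : Measure ℕ+) Set.univ MeasurableSet.univ
  simp only [Set.indicator_univ] at h
  have h₁ : ∑' k : ℕ+, (μ {k} : ℝ≥0∞) = ((1 : ℝ≥0) : ℝ≥0∞) := by
    rw [← hμ, FiniteMeasure.ennreal_mass, ← h]
    simp only [FiniteMeasure.ennreal_coeFn_eq_coeFn_toMeasure]
  have h₂ : HasSum (fun k : ℕ+ => μ {k}) 1 := by
    rw [← ENNReal.hasSum_coe, ← h₁]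
    exact ENNReal.summable.hasSum
  exact NNReal.coe_one ▸ NNReal.hasSum_coe.2 h₂

theorem hasSum_mul_measure_singleton {μ : FiniteMeasure ℕ+} {m : ℝ} (hm : 0 ≤ m)
    (hμ : mean μ = ENNReal.ofReal m) : HasSum (fun k : ℕ+ => ((k : ℕ) : ℝ) * (μ {k} : ℝ)) m := by
  rw [mean, lintegral_countable'] at hμ
  have h₁ : ∑' k : ℕ+, ((((k : ℕ) : ℝ≥0) * μ {k} : ℝ≥0) : ℝ≥0∞) = ((m.toNNReal : ℝ≥0) : ℝ≥0∞) := by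
    rw [← ENNReal.ofReal, ← hμ]
    simp only [ENNReal.coe_mul, ENNReal.coe_natCast, FiniteMeasure.ennreal_coeFn_eq_coeFn_toMeasure]
  have h₂ : HasSum (fun k : ℕ+ => ((k : ℕ) : ℝ≥0) * μ {k}) m.toNNReal := by
    rw [← ENNReal.hasSum_coe, ← h₁]
    exact ENNReal.summable.hasSum
  have h₃ := NNReal.hasSum_coe.2 h₂
  rw [Real.coe_toNNReal m hm] at h₃
  simpa only [NNReal.coe_mul, NNReal.coe_natCast] using h₃

theorem log_half_pow (k : ℕ) : Real.log ((1 / 2 : ℝ) ^ k) = -(k * Real.log 2) := by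
  rw [Real.log_pow, one_div, Real.log_inv, mul_neg]

section Gibbs

variable {μ : FiniteMeasure ℕ+} {m : ℝ}

/-- For the reference weights `2^{-k}` the cross-entropy is `∑ μ_k k log 2`, so it depends on `μ`
only through the mean; the two total masses cancel. -/
theorem hasSum_gibbs (hμ : μ.mass = 1) (hm : 0 ≤ m) (hmean : mean μ = ENNReal.ofReal m) :
    HasSum (fun k : ℕ+ => (1 / 2 : ℝ) ^ (k : ℕ) - (μ {k} : ℝ) -
      (μ {k} : ℝ) * Real.log ((1 / 2 : ℝ) ^ (k : ℕ))) (m * Real.log 2) := by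
  have h := (hasSum_half_pow_pnat.sub (hasSum_measure_singleton hμ)).add
    ((hasSum_mul_measure_singleton hm hmean).mul_right (Real.log 2))
  convert! h using 1
  · ext k
    rw [log_half_pow]
    ring
  · ring

theorem negMulLog_measure_singleton_nonneg (hμ : μ.mass = 1) (k : ℕ+) :
    0 ≤ Real.negMulLog (μ {k} : ℝ) := by
  refine Real.negMulLog_nonneg (NNReal.coe_nonneg _) ?_
  rw [← NNReal.coe_one, NNReal.coe_le_coe, ← hμ]
  exact μ.apply_mono (Set.subset_univ _)

/-- Without summability the `tsum` in `entropy` would be the default value 0, and termwise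
comparison would say nothing about it. -/
theorem summable_negMulLog (hμ : μ.mass = 1) (hm : 0 ≤ m) (hmean : mean μ = ENNReal.ofReal m) :
    Summable fun k : ℕ+ => Real.negMulLog (μ {k} : ℝ) :=
  Summable.of_nonneg_of_le (negMulLog_measure_singleton_nonneg hμ)
    (fun _ => negMulLog_le_sub_sub_mul_log (NNReal.coe_nonneg _) (by positivity))
    (hasSum_gibbs hμ hm hmean).summable

/-- Among the measures of mean `m`, the entropy is at most `m log 2`. -/
theorem entropy_le (hμ : μ.mass = 1) (hm : 0 ≤ m) (hmean : mean μ = ENNReal.ofReal m) :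
    entropy μ ≤ m * Real.log 2 :=
  hasSum_le (fun _ => negMulLog_le_sub_sub_mul_log (NNReal.coe_nonneg _) (by positivity))
    (summable_negMulLog hμ hm hmean).hasSum (hasSum_gibbs hμ hm hmean)

theorem FiniteMeasure.ext_singleton {μ ν : FiniteMeasure ℕ+} (h : ∀ k, μ {k} = ν {k}) : μ = ν := by
  apply Subtype.ext
  apply Measure.ext_of_singleton
  intro k
  have := congrArg ((↑) : ℝ≥0 → ℝ≥0∞) (h k)
  rwa [FiniteMeasure.ennreal_coeFn_eq_coeFn_toMeasure,
    FiniteMeasure.ennreal_coeFn_eq_coeFn_toMeasure] at this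

/-- The termwise Gibbs deficits are nonnegative and sum to 0, so each one vanishes and the pointwise
equality case applies. -/
theorem eq_geometricHalf_of_entropy_eq (hμ : μ.mass = 1) (hm : 0 ≤ m)
    (hmean : mean μ = ENNReal.ofReal m) (h : entropy μ = m * Real.log 2) :
    μ = geometricHalf.toFiniteMeasure := by
  have hs := (hasSum_gibbs hμ hm hmean).sub (summable_negMulLog hμ hm hmean).hasSum
  rw [← entropy, h, sub_self, hasSum_zero_iff_of_nonneg fun k => sub_nonneg.2
    (negMulLog_le_sub_sub_mul_log (NNReal.coe_nonneg _) (by positivity))] at hs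
  refine FiniteMeasure.ext_singleton fun k => NNReal.coe_injective ?_
  rw [geometricHalf_toFiniteMeasure_singleton]
  exact eq_of_negMulLog_eq (NNReal.coe_nonneg _) (by positivity)
    (sub_eq_zero.1 (congrFun hs k)).symm

theorem one_le_of_mean_eq (hμ : μ.mass = 1) (hm : 0 ≤ m) (hmean : mean μ = ENNReal.ofReal m) :
    1 ≤ m :=
  hasSum_le (fun k => le_mul_of_one_le_left (NNReal.coe_nonneg _) (by exact_mod_cast Nat.one_le_iff_ne_zero.2 k.ne_zero))
    (hasSum_measure_singleton hμ) (hasSum_mul_measure_singleton hm hmean)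

end Gibbs

theorem mean_geometricHalf : mean geometricHalf.toFiniteMeasure = ENNReal.ofReal 2 := by
  rw [mean, lintegral_countable', ← hasSum_mul_half_pow_pnat.tsum_eq,
    ENNReal.ofReal_tsum_of_nonneg (fun _ => by positivity) hasSum_mul_half_pow_pnat.summable]
  refine tsum_congr fun k => ?_
  change _ * geometricHalfAux {k} = _
  rw [geometricHalfAux_singleton, ENNReal.ofReal_mul (by positivity), ENNReal.ofReal_natCast,
    ENNReal.ofReal_pow (by positivity), one_div, ENNReal.ofReal_inv_of_pos two_pos,
    ENNReal.ofReal_ofNat]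

theorem entropy_geometricHalf : entropy geometricHalf.toFiniteMeasure = 2 * Real.log 2 := by
  rw [entropy, ← (hasSum_mul_half_pow_pnat.mul_right (Real.log 2)).tsum_eq]
  refine tsum_congr fun k => ?_
  rw [geometricHalf_toFiniteMeasure_singleton, Real.negMulLog, log_half_pow]
  ring

theorem binEntropy_one_div {m : ℝ} (hm : 1 < m) :
    Real.binEntropy (1 / m) = Real.log m - (1 - 1 / m) * Real.log (m - 1) := by
  have hm0 : m ≠ 0 := by positivity
  have h : 1 - 1 / m = (m - 1) / m := by field_simp
  rw [Real.binEntropy, Real.log_inv (1 - 1 / m), h, Real.log_div (by linarith) hm0, one_div,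
    inv_inv]
  field_simp
  ring

theorem log_four : Real.log 4 = 2 * Real.log 2 := by
  rw [show (4 : ℝ) = 2 ^ 2 by norm_num, Real.log_pow]
  norm_num

/-- For `m > 1`, the finite value of the rate function is the sum of an entropy deficit and a binary
entropy deficit. -/
theorem rate_eq_deficits {m : ℝ} (hm : 1 < m) (H : ℝ) :
    Real.log 4 - 1 / m * H - 1 / m * Real.log (m - 1) + Real.log (1 - 1 / m) =
      1 / m * (m * Real.log 2 - H) + (Real.log 2 - Real.binEntropy (1 / m)) := by
  have hm0 : m ≠ 0 := by positivity
  have h : 1 - 1 / m = (m - 1) / m := by field_simp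
  rw [binEntropy_one_div hm, log_four, h, Real.log_div (by linarith) hm0]
  field_simp
  ring

theorem rateFunction_eq_zero_iff (m : ℝ) (μ : FiniteMeasure ℕ+) (t : Set.Icc (0 : ℝ) 1) :
    rateFunction m μ t = 0 ↔
      m = 2 ∧ μ = geometricHalf.toFiniteMeasure ∧ (t : ℝ) = 1 / 4 := by
  unfold rateFunction
  constructor
  · intro h
    split_ifs at h with hc
    · obtain ⟨hμ, hmean, hmt⟩ := hc
      have hm0 : 0 ≤ m := by
        have := t.2.1
        rw [hmt]
        positivity
      have hent := entropy_le hμ hm0 hmean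
      have hlog : 0 < Real.log 2 := Real.log_pos one_lt_two
      rw [EReal.coe_eq_zero] at h
      rcases (one_le_of_mean_eq hμ hm0 hmean).eq_or_lt with rfl | hm
      -- For `m = 1` both logarithms are `Real.log 0 = 0`, so the value is `log 4 - H`, which is at
      -- least `log 2` because `H ≤ log 2`.
      · norm_num [log_four] at h
        linarith
      · rw [rate_eq_deficits hm] at h
        have h₁ : 0 ≤ 1 / m * (m * Real.log 2 - entropy μ) :=
          mul_nonneg (by positivity) (sub_nonneg.2 hent)
        have h₂ : Real.binEntropy (1 / m) ≤ Real.log 2 := Real.binEntropy_le_log_two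
        -- Two nonnegative deficits with sum 0 both vanish; the binary one forces `1 / m = 1 / 2`.
        have h₃ : Real.binEntropy (1 / m) = Real.log 2 := by linarith
        rw [Real.binEntropy_eq_log_two, one_div, inv_inj] at h₃
        subst h₃
        refine ⟨rfl, eq_geometricHalf_of_entropy_eq hμ hm0 hmean (by linarith), ?_⟩
        have ht : (t : ℝ) ≠ 0 := by
          intro h0
          rw [h0] at hmt
          norm_num at hmt
        field_simp at hmt
        linarith
    · exact absurd h EReal.top_ne_zero
  · rintro ⟨rfl, rfl, ht⟩
    rw [if_pos, EReal.coe_eq_zero, rate_eq_deficits one_lt_two, entropy_geometricHalf, one_div,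
      Real.binEntropy_two_inv]
    · ring
    · refine ⟨?_, mean_geometricHalf, by rw [ht]; norm_num⟩
      exact geometricHalf.mass_toFiniteMeasure

/-! ### Borel–Cantelli and weak convergence -/

theorem summable_deviation_bound {c : ℝ} (hc : 0 < c) :
    Summable fun n : ℕ => 4 * (n : ℝ) * (n + 1) * Real.exp (-c * n) := by
  have h := ((Real.summable_pow_mul_exp_neg_nat_mul 2 hc).add
    (Real.summable_pow_mul_exp_neg_nat_mul 1 hc)).mul_left 4
  convert! h using 2
  ring

section AlmostSure

variable {Ω : Type*} [MeasurableSpace Ω] {P : Measure Ω} {π : (n : ℕ+) → Ω → NC n}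

/-- First Borel–Cantelli lemma: only the marginal laws enter. -/
theorem ae_eventually_deviation_lt (hπ : ∀ n : ℕ+, HasLaw (π n) (uniformNC n) P) (k : ℕ) {ε : ℝ}
    (hε : 0 < ε) (hε' : ε ≤ 1) :
    ∀ᵐ ω ∂P, ∀ᶠ n : ℕ+ in atTop,
      |(letterCount (π n ω).code k : ℝ) - n * (1 / 2 : ℝ) ^ (k + 1)| < n * ε := by
  set B : (n : ℕ+) → Set (NC n) := fun n =>
    {ρ | n * ε ≤ |letterCount ρ.code k - n * (1 / 2 : ℝ) ^ (k + 1)|} with hB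
  have hsum : ∑' n : ℕ+, P (π n ⁻¹' B n) ≠ ∞ := by
    have hs := (summable_deviation_bound (c := ε ^ 2 / 4) (by positivity)).comp_injective
      PNat.coe_injective
    refine ne_top_of_le_ne_top hs.tsum_ofReal_ne_top (ENNReal.tsum_le_tsum fun n => ?_)
    rw [← Measure.map_apply_of_aemeasurable (hπ n).aemeasurable (MeasurableSet.of_discrete),
      (hπ n).map_eq]
    exact uniformNC_deviation_le n.pos hε hε'
  filter_upwards [ae_finite_setOfPred_mem hsum] with ω hω
  obtain ⟨N, hN⟩ := hω.bddAbove
  filter_upwards [eventually_gt_atTop N] with n hn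
  by_contra! h
  exact absurd (hN (show n ∈ {n | ω ∈ π n ⁻¹' B n} from h)) (not_le.2 hn)

theorem ae_tendsto_letterCount (hπ : ∀ n : ℕ+, HasLaw (π n) (uniformNC n) P) :
    ∀ᵐ ω ∂P, ∀ k : ℕ, Tendsto (fun n : ℕ+ => (letterCount (π n ω).code k : ℝ) / n) atTop
      (𝓝 ((1 / 2) ^ (k + 1))) := by
  rw [ae_all_iff]
  intro k
  -- Tolerances `1 / (j + 1)` make the exceptional set a countable union of null sets.
  have h : ∀ᵐ ω ∂P, ∀ j : ℕ, ∀ᶠ n : ℕ+ in atTop,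
      |(letterCount (π n ω).code k : ℝ) - n * (1 / 2 : ℝ) ^ (k + 1)| < n * (1 / ((j : ℝ) + 1)) := by
    rw [ae_all_iff]
    intro j
    refine ae_eventually_deviation_lt hπ k (by positivity) ?_
    rw [div_le_one (by positivity)]
    linarith [(Nat.cast_nonneg j : (0 : ℝ) ≤ j)]
  filter_upwards [h] with ω hω
  rw [Metric.tendsto_nhds]
  intro ε hε
  obtain ⟨j, hj⟩ := exists_nat_one_div_lt hε
  filter_upwards [hω j] with n hn
  have hn0 : (0 : ℝ) < n := by exact_mod_cast n.pos
  rw [Real.dist_eq]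
  refine lt_trans ?_ hj
  rw [← mul_lt_mul_iff_right₀ hn0]
  refine lt_of_eq_of_lt ?_ hn
  rw [← abs_of_pos hn0, ← abs_mul, abs_of_pos hn0, mul_sub, mul_div_cancel₀ _ hn0.ne']

end AlmostSure

/-- Each block contributes one nonzero letter, so the number of blocks is n minus the number of
zeros. Dividing by n writes the point mass through letter frequencies, whose limits are known. -/
theorem NC.blockMeasure_singleton {n : ℕ+} (π : NC n) (k : ℕ+) :
    (π.blockMeasure : Measure ℕ+) {k} = ENNReal.ofReal
      (((letterCount π.code k : ℝ) / n) / (1 - (letterCount π.code 0 : ℝ) / n)) := by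
  classical
  have hn : (0 : ℝ) < n := by exact_mod_cast n.pos
  have hne : NeZero (n : ℕ) := ⟨n.ne_zero⟩
  have hr : 0 < π.1.parts.card :=
    Finset.card_pos.2 (π.1.parts_nonempty (Finset.univ_nonempty.ne_empty))
  have hr' : (0 : ℝ) < π.1.parts.card := by exact_mod_cast hr
  have hzero : (n : ℝ) - letterCount π.code 0 = π.1.parts.card := by
    rw [sub_eq_iff_eq_add', letterCount]
    exact_mod_cast π.card_filter_code_eq_zero.symm
  have hfrac : ((letterCount π.code k : ℝ) / n) / (1 - (letterCount π.code 0 : ℝ) / n) =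
      letterCount π.code k / π.1.parts.card := by
    rw [← hzero]
    have : (n : ℝ) - letterCount π.code 0 ≠ 0 := by
      rw [hzero]
      exact hr'.ne'
    field_simp
  have hcount : ∑ V : π.1.parts, (Measure.dirac (π.blockSize V) : Measure ℕ+) {k} =
      (letterCount π.code k : ℝ≥0∞) := by
    have h : ∀ V : π.1.parts, (Measure.dirac (π.blockSize V) : Measure ℕ+) {k} =
        if V.1.card = k then 1 else 0 := by
      intro V
      rw [Measure.dirac_apply, Set.indicator_apply]
      refine if_congr ?_ rfl rfl
      rw [Set.mem_singleton_iff, ← PNat.coe_inj]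
      rfl
    simp only [h]
    rw [Finset.sum_coe_sort π.1.parts fun V => if V.card = k then (1 : ℝ≥0∞) else 0,
      Finset.sum_boole, letterCount, π.card_filter_code_eq k.ne_zero]
  rw [hfrac, ENNReal.ofReal_div_of_pos hr', ENNReal.ofReal_natCast, ENNReal.ofReal_natCast]
  change π.blockMeasureAux {k} = _
  rw [NC.blockMeasureAux, Measure.smul_apply, Measure.finsetSum_apply, hcount, smul_eq_mul, mul_comm,
    ENNReal.div_eq_inv_mul, mul_comm]

/-- On the positive integers, convergence of the point masses implies weak convergence. -/
theorem ProbabilityMeasure.tendsto_of_tendsto_singleton {ι : Type*} {l : Filter ι}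
    [l.IsCountablyGenerated] {μs : ι → ProbabilityMeasure ℕ+} {μ : ProbabilityMeasure ℕ+}
    (h : ∀ k, Tendsto (fun i => (μs i : Measure ℕ+) {k}) l (𝓝 ((μ : Measure ℕ+) {k}))) :
    Tendsto μs l (𝓝 μ) := by
  rcases l.eq_or_neBot with rfl | hl
  · exact tendsto_bot
  -- Portmanteau criterion on open sets; the required lower bound is Fatou's lemma for the counting
  -- measure.
  refine tendsto_of_forall_isOpen_le_liminf' fun G _ => ?_
  have hG : ∀ ν : ProbabilityMeasure ℕ+, (ν : Measure ℕ+) G =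
      ∫⁻ k, G.indicator (fun k => (ν : Measure ℕ+) {k}) k ∂Measure.count := fun ν => by
    rw [lintegral_count, Measure.tsum_indicator_apply_singleton _ _ MeasurableSet.of_discrete]
  simp only [hG]
  refine le_trans (lintegral_mono fun k => ?_)
    (lintegral_liminf_le' fun i => Measurable.aemeasurable .of_discrete)
  by_cases hk : k ∈ G
  · simp only [Set.indicator_of_mem hk]
    exact (h k).liminf_eq.ge
  · simp [Set.indicator_of_notMem hk]

theorem tendsto_blockMeasure_of_tendsto_letterCount {π : (n : ℕ+) → NC n}
    (h : ∀ k : ℕ, Tendsto (fun n : ℕ+ => (letterCount (π n).code k : ℝ) / n) atTop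
      (𝓝 ((1 / 2) ^ (k + 1)))) :
    Tendsto (fun n => (π n).blockMeasure) atTop (𝓝 geometricHalf) := by
  refine ProbabilityMeasure.tendsto_of_tendsto_singleton fun k => ?_
  simp only [NC.blockMeasure_singleton]
  -- The limit is `2^{-(k+1)} / (1 - 1/2) = 2^{-k}`, with a nonzero denominator.
  have hlim := (h k).div ((h 0).const_sub 1) (by norm_num)
  have hval : (geometricHalf : Measure ℕ+) {k} =
      ENNReal.ofReal ((1 / 2) ^ ((k : ℕ) + 1) / (1 - (1 / 2) ^ (0 + 1))) := by
    change geometricHalfAux {k} = _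
    have e : (1 / 2 : ℝ) ^ ((k : ℕ) + 1) / (1 - (1 / 2) ^ (0 + 1)) = 2⁻¹ ^ (k : ℕ) := by
      rw [pow_succ, one_div]
      norm_num
    rw [geometricHalfAux_singleton, e, ENNReal.ofReal_pow (by positivity),
      ENNReal.ofReal_inv_of_pos two_pos, ENNReal.ofReal_ofNat]
  rw [hval]
  exact ENNReal.tendsto_ofReal hlim

theorem mainTheorem7 :
    (∀ (Ω : Type*) [MeasurableSpace Ω] (P : Measure Ω) [IsProbabilityMeasure P]
      (π : (n : ℕ+) → Ω → NC n), (∀ n : ℕ+, HasLaw (π n) (uniformNC n) P) →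
      ∀ᵐ ω ∂P, Tendsto (fun n : ℕ+ => (π n ω).blockMeasure) atTop (𝓝 geometricHalf)) ∧
    (∀ (m : ℝ) (μ : FiniteMeasure ℕ+) (t : Set.Icc (0 : ℝ) 1),
      rateFunction m μ t = 0 ↔
        m = 2 ∧ μ = geometricHalf.toFiniteMeasure ∧ (t : ℝ) = 1 / 4) := by
  refine ⟨fun Ω _ P _ π hπ => ?_, rateFunction_eq_zero_iff⟩
  filter_upwards [ae_tendsto_letterCount hπ] with ω hω
  exact tendsto_blockMeasure_of_tendsto_letterCount hω
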